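/- Let $K$ be an algebraically closed field and $n\ge 2$. Let $f_1,\dots,f_{n-2}\in K[x_0,\dots,x_n]$ be forms of positive degrees $k_1,\dots,k_{n-2}$ whose common zero scheme $S\subset\mathbb P^n$ has dimension $2$, i.e. is a complete intersection surface, and let $C\subset\mathbb P^n$ be a curve (a closed subscheme of dimension $1$) lying on $S$. For a hyperplane $H\subset\mathbb P^n$ let $\Gamma=C\cap H$ be the scheme-theoretic intersection, with ideal sheaf $\mathcal I_\Gamma\subset\mathcal O_{\mathbb P^n}$, and put $$\beta_l=h^0(\mathbb P^n,\mathcal O(l))-h^0(\mathbb P^n,\mathcal I_\Gamma(l))\quad(l\ge 0),\qquad \gamma_0=\beta_0,\qquad \gamma_l=\beta_l-\beta_{l-1}\quad(l\ge 1).$$ Then for a general hyperplane $H$ (that is, for all $H$ in some nonempty Zariski open subset of the dual projective space, depending only on $C$ and $f_1,\dots,f_{n-2}$) one has $$\gamma_{i+1}\le\gamma_i\qquad\text{for all integers } i\ge k_1+\cdots+k_{n-2}.$$ -/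

import Mathlib

open MvPolynomial

/-- The homogeneous coordinate ring `K[x_0, …, x_n]` of projective `n`-space over `K`. A closed
subscheme of projective space is given by a homogeneous ideal of this ring. -/
abbrev CoordRing (K : Type*) [Field K] (n : ℕ) : Type _ := MvPolynomial (Fin (n + 1)) K

section

variable {K : Type*} [Field K] {n : ℕ}

/-- The ideal `I` is homogeneous: it contains the homogeneous components of its elements. -/
def IsHomogIdeal (I : Ideal (CoordRing K n)) : Prop :=
  ∀ F ∈ I, ∀ e : ℕ, homogeneousComponent e F ∈ I

/-- The closed subscheme of projective `n`-space defined by the homogeneous ideal `I` has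
dimension `d`, that is, its affine cone has Krull dimension `d + 1`. -/
def HasProjDim (I : Ideal (CoordRing K n)) (d : ℕ) : Prop :=
  ringKrullDim (CoordRing K n ⧸ I) = ((d + 1 : ℕ) : WithBot ℕ∞)

/-- `f_1, …, f_{n-2}` are forms of positive degrees `k_1, …, k_{n-2}` on projective `n`-space whose
common zero scheme is a (complete intersection) surface. -/
structure IsCompleteIntersectionSurface (f : Fin (n - 2) → CoordRing K n)
    (k : Fin (n - 2) → ℕ) : Prop where
  degree_pos : ∀ j, 0 < k j
  isHomogeneous : ∀ j, (f j).IsHomogeneous (k j)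
  dim_eq_two : HasProjDim (Ideal.span (Set.range f)) 2

/-- The homogeneous ideal `I` defines a curve, a closed subscheme of dimension one. -/
structure IsCurve (I : Ideal (CoordRing K n)) : Prop where
  isHomogeneous : IsHomogIdeal I
  dim_eq_one : HasProjDim I 1

/-- The equation `a_0 x_0 + ⋯ + a_n x_n` of the hyperplane with dual coordinates `a`. -/
noncomputable def linearForm (a : Fin (n + 1) → K) : CoordRing K n :=
  ∑ j, C (a j) * X j

/-- A homogeneous ideal defining the scheme-theoretic intersection of the closed subscheme defined
by `I` with the hyperplane `a`. -/
noncomputable def hyperplaneSection (I : Ideal (CoordRing K n)) (a : Fin (n + 1) → K) :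
    Ideal (CoordRing K n) :=
  I ⊔ Ideal.span {linearForm a}

/-- A property holds for a general hyperplane: it holds for all hyperplanes in a nonempty Zariski
open subset of the dual projective space. (Every nonempty open subset contains a nonempty basic
open subset, the locus where a nonzero form `F` in the dual coordinates does not vanish.) -/
def ForGeneralHyperplane (P : (Fin (n + 1) → K) → Prop) : Prop :=
  ∃ (e : ℕ) (F : MvPolynomial (Fin (n + 1)) K), F.IsHomogeneous e ∧ F ≠ 0 ∧
    ∀ a : Fin (n + 1) → K, a ≠ 0 → eval a F ≠ 0 → P a

/-- The space `H⁰(ℙⁿ, 𝓘(l))` for the ideal sheaf `𝓘` of the closed subscheme defined by `I`: the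
forms of degree `l` (these are the global sections of `𝓞(l)`) which on each standard affine chart
`x_j ≠ 0` lie in the ideal of the subscheme, i.e. which lie in `I` after multiplication with a
power of `x_j`. -/
def idealSheafSections (I : Ideal (CoordRing K n)) (l : ℕ) : Submodule K (CoordRing K n) where
  carrier := {F | F ∈ homogeneousSubmodule (Fin (n + 1)) K l ∧
    ∀ j : Fin (n + 1), ∃ N : ℕ, X j ^ N * F ∈ I}
  zero_mem' := ⟨Submodule.zero_mem _, fun j => ⟨0, by simp⟩⟩
  add_mem' := by
    rintro F G ⟨hF, hF'⟩ ⟨hG, hG'⟩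
    refine ⟨Submodule.add_mem _ hF hG, fun j => ?_⟩
    obtain ⟨N, hN⟩ := hF' j
    obtain ⟨M, hM⟩ := hG' j
    refine ⟨N + M, ?_⟩
    have h : (X j ^ (N + M) * (F + G) : CoordRing K n)
        = X j ^ M * (X j ^ N * F) + X j ^ N * (X j ^ M * G) := by ring
    rw [h]
    exact I.add_mem (I.mul_mem_left _ hN) (I.mul_mem_left _ hM)
  smul_mem' := by
    rintro c F ⟨hF, hF'⟩
    refine ⟨Submodule.smul_mem _ c hF, fun j => ?_⟩
    obtain ⟨N, hN⟩ := hF' j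
    refine ⟨N, ?_⟩
    rw [mul_smul_comm]
    exact Submodule.smul_of_tower_mem I c hN

/-- The Hilbert function `β_l = h⁰(ℙⁿ, 𝓞(l)) - h⁰(ℙⁿ, 𝓘(l))` of the closed subscheme with ideal
sheaf `𝓘` defined by `I`. -/
noncomputable def hilbertBeta (I : Ideal (CoordRing K n)) (l : ℕ) : ℤ :=
  (Module.finrank K (homogeneousSubmodule (Fin (n + 1)) K l) : ℤ)
    - (Module.finrank K (idealSheafSections I l) : ℤ)

/-- The difference function of the Hilbert function: `γ_0 = β_0` and `γ_l = β_l - β_{l-1}` for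
`l ≥ 1`. -/
noncomputable def hilbertGamma (I : Ideal (CoordRing K n)) : ℕ → ℤ
  | 0 => hilbertBeta I 0
  | l + 1 => hilbertBeta I (l + 1) - hilbertBeta I l

end

attribute [local instance] MvPolynomial.gradedAlgebra

section Homogeneous

variable {K : Type*} [Field K] {n : ℕ}

lemma coe_decompose_eq_homogeneousComponent (F : CoordRing K n) (e : ℕ) :
    (DirectSum.decompose (homogeneousSubmodule (Fin (n + 1)) K) F e : CoordRing K n) =
      homogeneousComponent e F :=
  decomposition.decompose'_apply F e

lemma isHomogIdeal_iff_isHomogeneous {I : Ideal (CoordRing K n)} :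
    IsHomogIdeal I ↔ I.IsHomogeneous (homogeneousSubmodule (Fin (n + 1)) K) :=
  ⟨fun h e F hF => coe_decompose_eq_homogeneousComponent F e ▸ h F hF e, fun h _ hF e => homogeneousComponent_mem_of_mem h hF e⟩

lemma IsHomogIdeal.sup {I J : Ideal (CoordRing K n)} (hI : IsHomogIdeal I)
    (hJ : IsHomogIdeal J) : IsHomogIdeal (I ⊔ J) := by
  rw [isHomogIdeal_iff_isHomogeneous] at *
  exact Ideal.IsHomogeneous.sup hI hJ

lemma isHomogIdeal_span {s : Set (CoordRing K n)} (hs : ∀ g ∈ s, ∃ e, g.IsHomogeneous e) :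
    IsHomogIdeal (Ideal.span s) := by
  rw [isHomogIdeal_iff_isHomogeneous]
  exact Ideal.homogeneous_span _ _ fun g hg => hs g hg

lemma homogeneousComponent_add_mul {g : CoordRing K n} {e : ℕ} (hg : g.IsHomogeneous e)
    (d : ℕ) (w : CoordRing K n) :
    homogeneousComponent (d + e) (g * w) = g * homogeneousComponent d w := by
  have h := DirectSum.coe_decompose_mul_of_left_mem_of_le
    (homogeneousSubmodule (Fin (n + 1)) K) (b := w) (n := d + e) hg (Nat.le_add_left e d)
  rwa [Nat.add_sub_cancel, coe_decompose_eq_homogeneousComponent,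
    coe_decompose_eq_homogeneousComponent] at h

lemma homogeneousComponent_mul_of_lt {g : CoordRing K n} {e : ℕ} (hg : g.IsHomogeneous e)
    {d : ℕ} (hd : d < e) (w : CoordRing K n) :
    homogeneousComponent d (g * w) = 0 := by
  rw [← coe_decompose_eq_homogeneousComponent]
  exact DirectSum.coe_decompose_mul_of_left_mem_of_not_le
    (homogeneousSubmodule (Fin (n + 1)) K) (b := w) hg (Nat.not_le.mpr hd)

lemma mem_of_homogeneousComponent_mem {I : Ideal (CoordRing K n)} {F : CoordRing K n}
    (h : ∀ e, homogeneousComponent e F ∈ I) : F ∈ I := by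
  rw [← sum_homogeneousComponent F]
  exact I.sum_mem fun e _ => h e

lemma isHomogeneous_linearForm (a : Fin (n + 1) → K) : (linearForm a).IsHomogeneous 1 :=
  IsHomogeneous.sum _ _ _ fun _ _ => isHomogeneous_C_mul_X _ _

lemma mem_idealOfVars_of_isHomogeneous {g : CoordRing K n} {e : ℕ} (he : 0 < e)
    (hg : g.IsHomogeneous e) : g ∈ idealOfVars (Fin (n + 1)) K := by
  rw [← pow_one (idealOfVars _ _), mem_pow_idealOfVars_iff]
  intro x hx
  have := hg.degree_eq_sum_deg_support hx
  rw [Finsupp.degree_apply]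
  omega

lemma IsHomogIdeal.le_idealOfVars {I : Ideal (CoordRing K n)} (hI : IsHomogIdeal I)
    (h : I ≠ ⊤) : I ≤ idealOfVars (Fin (n + 1)) K := by
  intro F hF
  rw [← pow_one (idealOfVars _ _), mem_pow_idealOfVars_iff']
  intro x hx
  have hx0 : x = 0 := by
    rw [Nat.lt_one_iff] at hx
    exact (Finsupp.degree_eq_zero_iff x).mp hx
  subst hx0
  by_contra hc
  have h0 := hI F hF 0
  rw [homogeneousComponent_zero] at h0
  exact h (Ideal.eq_top_of_isUnit_mem _ h0 ((isUnit_iff_ne_zero.mpr hc).map C))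

lemma exists_forall_isHomogeneous_mem {J : Ideal (CoordRing K n)}
    (h : idealOfVars (Fin (n + 1)) K ≤ J.radical) :
    ∃ D, ∀ d, D ≤ d → ∀ F : CoordRing K n, F.IsHomogeneous d → F ∈ J := by
  obtain ⟨D, hD⟩ := Ideal.exists_pow_le_of_le_radical_of_fg h (idealOfVars_fg _ _)
  refine ⟨D, fun d hd F hF => hD ?_⟩
  rw [mem_pow_idealOfVars_iff]
  intro x hx
  have := hF.degree_eq_sum_deg_support hx
  rw [Finsupp.degree_apply]
  omega

lemma isPrime_idealOfVars : (idealOfVars (Fin (n + 1)) K).IsPrime := by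
  have : idealOfVars (Fin (n + 1)) K
      = RingHom.ker (constantCoeff : CoordRing K n →+* K) := by
    ext F
    rw [← pow_one (idealOfVars _ _), mem_pow_idealOfVars_iff', RingHom.mem_ker]
    simp [Finsupp.degree_eq_zero_iff, constantCoeff_eq]
  rw [this]
  exact RingHom.ker_isPrime _

end Homogeneous

section RegularSequence

/-- Multiplication by `a` is injective modulo the ideal `J`. -/
def IsRegularMod {R : Type*} [CommRing R] (J : Ideal R) (a : R) : Prop :=
  ∀ z, a * z ∈ J → z ∈ J

/-- Every member of the list is regular modulo `J` and the preceding members. -/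
def IsRegularSeqMod {R : Type*} [CommRing R] : Ideal R → List R → Prop
  | _, [] => True
  | J, a :: l => IsRegularMod J a ∧ IsRegularSeqMod (J ⊔ Ideal.span {a}) l

variable {R : Type*} [CommRing R]

lemma isRegularSeqMod_append {J : Ideal R} {l₁ l₂ : List R} :
    IsRegularSeqMod J (l₁ ++ l₂) ↔
      IsRegularSeqMod J l₁ ∧ IsRegularSeqMod (J ⊔ Ideal.ofList l₁) l₂ := by
  induction l₁ generalizing J with
  | nil => simp [IsRegularSeqMod]
  | cons a l ih => simp [IsRegularSeqMod, ih, Ideal.ofList_cons, and_assoc, sup_assoc]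

lemma IsRegularMod.pow {J : Ideal R} {a : R} (h : IsRegularMod J a) (s : ℕ) :
    IsRegularMod J (a ^ s) := by
  induction s with
  | zero => intro z hz; simpa using hz
  | succ s ih =>
    intro z hz
    rw [pow_succ, mul_assoc] at hz
    exact h _ (ih _ hz)

lemma IsRegularMod.of_mem_radical {J : Ideal R} {a b : R} (h : IsRegularMod J a)
    (hab : a ∈ (J ⊔ Ideal.span {b}).radical) : IsRegularMod J b := by
  obtain ⟨s, hs⟩ := hab
  obtain ⟨j, hj, u, hu, hju⟩ := Submodule.mem_sup.mp hs
  obtain ⟨c, rfl⟩ := Ideal.mem_span_singleton'.mp hu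
  intro z hz
  refine h.pow s z ?_
  rw [← hju, add_mul, mul_assoc c]
  exact J.add_mem (J.mul_mem_right _ hj) (J.mul_mem_left _ hz)

lemma IsRegularMod.swap_right {J : Ideal R} {a b : R} (ha : IsRegularMod J a)
    (hb : IsRegularMod (J ⊔ Ideal.span {a}) b) : IsRegularMod (J ⊔ Ideal.span {b}) a := by
  intro z hz
  obtain ⟨j, hj, u, hu, hju⟩ := Submodule.mem_sup.mp hz
  obtain ⟨w, rfl⟩ := Ideal.mem_span_singleton'.mp hu
  have hw : w ∈ J ⊔ Ideal.span {a} := by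
    refine hb w ?_
    have : b * w = a * z - j := by rw [← hju]; ring
    rw [this]
    exact Submodule.sub_mem _ (Ideal.mul_mem_right _ _ (Ideal.mem_sup_right
      (Ideal.mem_span_singleton_self a))) (Ideal.mem_sup_left hj)
  obtain ⟨j', hj', u', hu', hw'⟩ := Submodule.mem_sup.mp hw
  obtain ⟨w', rfl⟩ := Ideal.mem_span_singleton'.mp hu'
  have h1 : z - w' * b ∈ J := by
    refine ha _ ?_
    have : a * (z - w' * b) = j + j' * b := by
      linear_combination -hju - b * hw'
    rw [this]
    exact J.add_mem hj (J.mul_mem_right _ hj')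
  have : z = (z - w' * b) + w' * b := by ring
  rw [this]
  exact Submodule.add_mem _ (Ideal.mem_sup_left h1)
    (Ideal.mem_sup_right (Ideal.mul_mem_left _ _ (Ideal.mem_span_singleton_self b)))

lemma IsRegularSeqMod.map {S : Type*} [CommRing S] (e : R ≃+* S) {J : Ideal R} {l : List R}
    (h : IsRegularSeqMod J l) : IsRegularSeqMod (J.map e) (l.map e) := by
  induction l generalizing J with
  | nil => trivial
  | cons a l ih =>
    refine ⟨fun z hz => ?_, ?_⟩
    · obtain ⟨y, rfl⟩ := e.surjective z
      rw [← map_mul] at hz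
      have key : ∀ x, e x ∈ J.map e ↔ x ∈ J := by
        intro x
        rw [Ideal.mem_map_of_equiv]
        exact ⟨fun ⟨y, hy, hyx⟩ => e.injective hyx ▸ hy, fun hx => ⟨x, hx, rfl⟩⟩
      rw [key] at hz ⊢
      exact h.1 _ hz
    · have := ih h.2
      rwa [Ideal.map_sup, Ideal.map_span, Set.image_singleton] at this

end RegularSequence

section HomogeneousRegular

variable {K : Type*} [Field K] {n : ℕ}

lemma IsRegularMod.swap_left {J : Ideal (CoordRing K n)} (hJ : IsHomogIdeal J)
    {a b : CoordRing K n} {d e : ℕ} (hd : 0 < d) (had : a.IsHomogeneous d)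
    (hbe : b.IsHomogeneous e) (ha : IsRegularMod J a)
    (hb : IsRegularMod (J ⊔ Ideal.span {a}) b) : IsRegularMod J b := by
  have key : ∀ t, ∀ z : CoordRing K n, z.IsHomogeneous t → b * z ∈ J → z ∈ J := by
    intro t
    induction t using Nat.strong_induction_on with
    | _ t ih =>
      intro z hzt hz
      obtain ⟨j, hj, u, hu, hju⟩ := Submodule.mem_sup.mp (hb z (Ideal.mem_sup_left hz))
      obtain ⟨w, rfl⟩ := Ideal.mem_span_singleton'.mp hu
      have hbw : b * w ∈ J := by
        refine ha _ ?_
        have : a * (b * w) = b * z - b * j := by rw [← hju]; ring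
        rw [this]
        exact J.sub_mem hz (J.mul_mem_left _ hj)
      have hzc : z = homogeneousComponent t j + homogeneousComponent t (a * w) := by
        rw [← map_add, mul_comm a w, hju, homogeneousComponent_eq_self hzt]
      rw [hzc]
      refine J.add_mem (hJ _ hj t) ?_
      rcases lt_or_ge t d with htd | htd
      · rw [homogeneousComponent_mul_of_lt had htd]
        exact J.zero_mem
      · obtain ⟨s, rfl⟩ := Nat.exists_eq_add_of_le' htd
        rw [homogeneousComponent_add_mul had]
        refine J.mul_mem_left _ (ih s (by omega) _ (homogeneousComponent_isHomogeneous _ _) ?_)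
        rw [← homogeneousComponent_add_mul hbe]
        exact hJ _ hbw _
  intro z hz
  refine mem_of_homogeneousComponent_mem fun t => ?_
  refine key t _ (homogeneousComponent_isHomogeneous _ _) ?_
  rw [← homogeneousComponent_add_mul hbe]
  exact hJ _ hz _

/-- A regular sequence of forms of positive degree stays regular when its first member is moved
to the end. -/
lemma IsRegularSeqMod.rotate {J : Ideal (CoordRing K n)} (hJ : IsHomogIdeal J)
    {a : CoordRing K n} {d : ℕ} (hd : 0 < d) (had : a.IsHomogeneous d)
    {l : List (CoordRing K n)} (hl : ∀ g ∈ l, ∃ e, g.IsHomogeneous e)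
    (h : IsRegularSeqMod J (a :: l)) : IsRegularSeqMod J (l ++ [a]) := by
  induction l generalizing J with
  | nil => exact h
  | cons b l ih =>
    obtain ⟨ha, hb, hl'⟩ := h
    obtain ⟨e, hbe⟩ := hl b (by simp)
    refine ⟨ha.swap_left hJ hd had hbe hb, ih (hJ.sup (isHomogIdeal_span ?_)) ?_ ⟨?_, ?_⟩⟩
    · rintro g rfl
      exact ⟨e, hbe⟩
    · exact fun g hg => hl g (by simp [hg])
    · exact ha.swap_right hb
    · rwa [sup_right_comm]

/-- Let the linear form `ℓ` be regular modulo `J`, let `(J, g)` contain all forms of large degree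
and let `(J, ℓ)` contain all forms of degree greater than `s`. Then `(J, g)` contains all
forms of degree greater than `s + deg g - 1`. -/
lemma mem_sup_span_of_exchange {J : Ideal (CoordRing K n)} (hJ : IsHomogIdeal J)
    {l g : CoordRing K n} {e s : ℕ} (he : 0 < e) (hl : l.IsHomogeneous 1)
    (hg : g.IsHomogeneous e) (hreg : IsRegularMod J l)
    (hrad : idealOfVars (Fin (n + 1)) K ≤ (J ⊔ Ideal.span {g}).radical)
    (hs : ∀ d, s < d → ∀ F : CoordRing K n, F.IsHomogeneous d → F ∈ J ⊔ Ideal.span {l}) :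
    ∀ d, s + (e - 1) < d → ∀ F : CoordRing K n, F.IsHomogeneous d →
      F ∈ J ⊔ Ideal.span {g} := by
  obtain ⟨D, hD⟩ := exists_forall_isHomogeneous_mem hrad
  have key : ∀ t d, s + (e - 1) < d → D ≤ d + t → ∀ F : CoordRing K n, F.IsHomogeneous d →
      F ∈ J ⊔ Ideal.span {g} := by
    intro t
    induction t with
    | zero => exact fun d _ hDd F hF => hD d hDd F hF
    | succ t ih =>
      intro d hd hDd F hF
      have hlF : l * F ∈ J ⊔ Ideal.span {g} :=
        ih (1 + d) (by omega) (by omega) _ (hl.mul hF)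
      obtain ⟨j, hj, u, hu, hju⟩ := Submodule.mem_sup.mp hlF
      obtain ⟨w, rfl⟩ := Ideal.mem_span_singleton'.mp hu
      obtain ⟨c, rfl⟩ : ∃ c, d = c + (e - 1) := ⟨d - (e - 1), by omega⟩
      have hcomp : l * F = homogeneousComponent (c + e) j + g * homogeneousComponent c w := by
        rw [← homogeneousComponent_add_mul hg, ← map_add, mul_comm g w, hju,
          homogeneousComponent_eq_self]
        have := hl.mul hF
        rwa [show 1 + (c + (e - 1)) = c + e by omega] at this
      obtain ⟨j', hj', u', hu', hw'⟩ := Submodule.mem_sup.mp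
        (hs c (by omega) _ (homogeneousComponent_isHomogeneous c w))
      obtain ⟨w', rfl⟩ := Ideal.mem_span_singleton'.mp hu'
      have h1 : F - w' * g ∈ J := by
        refine hreg _ ?_
        have : l * (F - w' * g) = homogeneousComponent (c + e) j + g * j' := by
          linear_combination hcomp - g * hw'
        rw [this]
        exact J.add_mem (hJ _ hj _) (J.mul_mem_left _ hj')
      have : F = (F - w' * g) + w' * g := by ring
      rw [this]
      exact Submodule.add_mem _ (Ideal.mem_sup_left h1)
        (Ideal.mem_sup_right (Ideal.mul_mem_left _ _ (Ideal.mem_span_singleton_self g)))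
  exact fun d hd F hF => key D d hd (by omega) F hF

end HomogeneousRegular

section GenericLinearForm

variable {K : Type*} [Field K] {n : ℕ}

lemma linearForm_add (a b : Fin (n + 1) → K) :
    linearForm (a + b) = linearForm a + linearForm b := by
  simp [linearForm, add_mul, Finset.sum_add_distrib]

lemma linearForm_smul (c : K) (a : Fin (n + 1) → K) :
    linearForm (c • a) = c • linearForm a := by
  simp [linearForm, Finset.smul_sum, MvPolynomial.smul_eq_C_mul, mul_assoc]

lemma linearForm_single (j : Fin (n + 1)) :
    linearForm (Pi.single j (1 : K)) = X j := by
  rw [linearForm, Finset.sum_eq_single j]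
  · simp
  · intro i _ hij
    simp [hij]
  · simp

lemma eval_linearForm (a x : Fin (n + 1) → K) : eval x (linearForm a) = a ⬝ᵥ x := by
  simp [linearForm, dotProduct]

/-- An ideal not containing all variables contains only special linear forms: those whose
coefficient vectors lie on a hyperplane. -/
lemma exists_linearForm_eval_ne_zero_imp {p : Ideal (CoordRing K n)}
    (hp : ¬ idealOfVars (Fin (n + 1)) K ≤ p) :
    ∃ c : Fin (n + 1) → K, linearForm c ≠ 0 ∧
      ∀ a, eval a (linearForm c) ≠ 0 → linearForm a ∉ p := by
  let W : Submodule K (Fin (n + 1) → K) :=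
    { carrier := {a | linearForm a ∈ p}
      add_mem' := fun {a b} ha hb => by
        simp only [Set.mem_ofPred_eq, linearForm_add] at *
        exact p.add_mem ha hb
      zero_mem' := by simp [linearForm]
      smul_mem' := fun c a ha => by
        simp only [Set.mem_ofPred_eq, linearForm_smul] at *
        exact Submodule.smul_of_tower_mem p c ha }
  have hW : W < ⊤ := by
    rw [lt_top_iff_ne_top]
    intro h
    refine hp (Ideal.span_le.mpr ?_)
    rintro _ ⟨j, rfl⟩
    have : Pi.single j (1 : K) ∈ W := h ▸ Submodule.mem_top
    rw [← linearForm_single]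
    exact this
  obtain ⟨φ, hφ, hle⟩ := Submodule.exists_le_ker_of_lt_top W hW
  have heval : ∀ a, eval a (linearForm fun j => φ (Pi.single j 1)) = φ a := by
    intro a
    rw [eval_linearForm, dotProduct]
    conv_rhs => rw [show a = ∑ j, a j • Pi.single j (1 : K) by
      ext i; simp [Finset.sum_apply, Pi.single_apply]]
    simp only [map_sum, map_smul, smul_eq_mul, mul_comm]
  refine ⟨fun j => φ (Pi.single j 1), fun h0 => hφ (LinearMap.ext fun a => ?_),
    fun a ha hmem => ?_⟩
  · rw [← heval, h0, map_zero, LinearMap.zero_apply]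
  · rw [heval] at ha
    exact ha (hle hmem)

/-- A general linear form lies in none of finitely many given ideals which do not contain all
variables. -/
lemma exists_isHomogeneous_forall_linearForm_notMem {S : Set (Ideal (CoordRing K n))}
    (hS : S.Finite) (h : ∀ p ∈ S, ¬ idealOfVars (Fin (n + 1)) K ≤ p) :
    ∃ (e : ℕ) (F : CoordRing K n), F.IsHomogeneous e ∧ F ≠ 0 ∧
      ∀ a, eval a F ≠ 0 → ∀ p ∈ S, linearForm a ∉ p := by
  induction S, hS using Set.Finite.induction_on with
  | empty => exact ⟨0, 1, isHomogeneous_one _ _, one_ne_zero, by simp⟩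
  | @insert p S _ _ ih =>
    obtain ⟨e, F, hF, hF0, hFa⟩ := ih fun q hq => h q (Set.mem_insert_of_mem _ hq)
    obtain ⟨c, hc0, hc⟩ := exists_linearForm_eval_ne_zero_imp (h p (Set.mem_insert _ _))
    refine ⟨1 + e, linearForm c * F, (isHomogeneous_linearForm c).mul hF, mul_ne_zero hc0 hF0, ?_⟩
    intro a ha q hq
    rw [map_mul] at ha
    rcases Set.mem_insert_iff.mp hq with rfl | hq
    · exact hc a (left_ne_zero_of_mul ha)
    · exact hFa a (right_ne_zero_of_mul ha) q hq

lemma exists_linearForm_forall_notMem [Infinite K] {S : Set (Ideal (CoordRing K n))}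
    (hS : S.Finite) (h : ∀ p ∈ S, ¬ idealOfVars (Fin (n + 1)) K ≤ p) :
    ∃ a : Fin (n + 1) → K, ∀ p ∈ S, linearForm a ∉ p := by
  obtain ⟨e, F, -, hF0, hFa⟩ := exists_isHomogeneous_forall_linearForm_notMem hS h
  by_contra! hc
  refine hF0 (MvPolynomial.funext fun a => ?_)
  rw [map_zero]
  by_contra ha
  obtain ⟨p, hp, hpa⟩ := hc a
  exact hFa a ha p hp hpa

end GenericLinearForm

section Dimension

lemma ringKrullDim_quotient_sup_span_add_one_le {R : Type*} [CommRing R] {J : Ideal R} {r : R}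
    (hr : ∀ p ∈ J.minimalPrimes, r ∉ p) :
    ringKrullDim (R ⧸ (J ⊔ Ideal.span {r})) + 1 ≤ ringKrullDim (R ⧸ J) := by
  have hsub : PrimeSpectrum.zeroLocus (R := R) (J ⊔ Ideal.span {r} : Ideal R) ⊆
      PrimeSpectrum.zeroLocus J :=
    PrimeSpectrum.zeroLocus_anti_mono (SetLike.coe_subset_coe.mpr le_sup_left)
  rw [ringKrullDim_quotient, ringKrullDim_quotient]
  by_cases hne : Nonempty (PrimeSpectrum.zeroLocus (R := R) (J ⊔ Ideal.span {r} : Ideal R))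
  swap
  · rw [not_nonempty_iff] at hne
    rw [Order.krullDim_eq_bot]
    simp
  have : Nonempty (PrimeSpectrum.zeroLocus (R := R) (J : Set R)) :=
    ⟨⟨hne.some.1, hsub hne.some.2⟩⟩
  rw [Order.krullDim_eq_iSup_length, Order.krullDim_eq_iSup_length, ← WithBot.coe_one,
    ← WithBot.coe_add, ENat.iSup_add, WithBot.coe_le_coe, iSup_le_iff]
  intro l
  have hhead : J ⊔ Ideal.span {r} ≤ l.head.1.asIdeal := l.head.2
  obtain ⟨p, hp, hple⟩ := Ideal.exists_minimalPrimes_le (le_sup_left.trans hhead)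
  let p' : PrimeSpectrum.zeroLocus (R := R) (J : Set R) := ⟨⟨p, hp.1.1⟩, hp.1.2⟩
  let l' : LTSeries (PrimeSpectrum.zeroLocus (R := R) (J : Set R)) :=
    l.map (fun q => ⟨q.1, hsub q.2⟩) (fun _ _ h => h)
  have hlt : p' < l'.head := by
    refine lt_of_le_of_ne hple fun h => hr p hp ?_
    have h1 : p = l.head.1.asIdeal := congrArg (fun q => q.1.asIdeal) h
    rw [h1]
    exact hhead (Ideal.mem_sup_right (Ideal.mem_span_singleton_self r))
  refine le_trans ?_ (le_iSup _ (l'.cons p' hlt))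
  simp only [RelSeries.cons_length, Nat.cast_add, Nat.cast_one]
  exact le_rfl

variable {K : Type*} [Field K] {n : ℕ}

lemma IsHomogIdeal.of_mem_minimalPrimes {J p : Ideal (CoordRing K n)} (hJ : IsHomogIdeal J)
    (hp : p ∈ J.minimalPrimes) : IsHomogIdeal p := by
  rw [isHomogIdeal_iff_isHomogeneous] at *
  have hcore := Ideal.IsPrime.homogeneousCore (𝒜 := homogeneousSubmodule (Fin (n + 1)) K) hp.1.1
  have hle := Ideal.toIdeal_homogeneousCore_le (homogeneousSubmodule (Fin (n + 1)) K) p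
  have hJle : J ≤ (p.homogeneousCore (homogeneousSubmodule (Fin (n + 1)) K)).toIdeal := by
    have := Ideal.homogeneousCore_mono (homogeneousSubmodule (Fin (n + 1)) K) hp.1.2
    rw [← hJ.toIdeal_homogeneousCore_eq_self]
    exact this
  rw [le_antisymm (hp.2 ⟨hcore, hJle⟩ hle) hle]
  exact HomogeneousIdeal.isHomogeneous _

lemma IsHomogIdeal.le_idealOfVars_of_mem_minimalPrimes {J p : Ideal (CoordRing K n)}
    (hJ : IsHomogIdeal J) (hp : p ∈ J.minimalPrimes) : p ≤ idealOfVars (Fin (n + 1)) K :=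
  (hJ.of_mem_minimalPrimes hp).le_idealOfVars hp.1.1.ne_top

lemma idealOfVars_le_radical_of_minimalPrimes {J : Ideal (CoordRing K n)}
    (h : ∀ p ∈ J.minimalPrimes, idealOfVars (Fin (n + 1)) K ≤ p) :
    idealOfVars (Fin (n + 1)) K ≤ J.radical := by
  rw [← Ideal.sInf_minimalPrimes]
  exact le_sInf h

lemma isMaximal_idealOfVars : (idealOfVars (Fin (n + 1)) K).IsMaximal := by
  refine Ideal.isMaximal_iff.mpr ⟨fun h => isPrime_idealOfVars.ne_top
    ((Ideal.eq_top_iff_one _).mpr h), fun M F hM hF hFM => ?_⟩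
  have h0 : F - C (coeff 0 F) ∈ idealOfVars (Fin (n + 1)) K := by
    rw [← pow_one (idealOfVars _ _), mem_pow_idealOfVars_iff']
    intro x hx
    rw [Nat.lt_one_iff] at hx
    obtain rfl : x = 0 := (Finsupp.degree_eq_zero_iff x).mp hx
    simp
  have hc : coeff 0 F ≠ 0 := by
    intro h
    rw [h, C_0, sub_zero] at h0
    exact hF h0
  have hCM : C (coeff 0 F) ∈ M := by
    have := M.sub_mem hFM (hM h0)
    rwa [sub_sub_cancel] at this
  rw [← Ideal.eq_top_iff_one]
  exact Ideal.eq_top_of_isUnit_mem _ hCM ((isUnit_iff_ne_zero.mpr hc).map C)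

lemma idealOfVars_le_radical_of_ringKrullDim_le_zero {J : Ideal (CoordRing K n)}
    (hJ : IsHomogIdeal J) (hdim : ringKrullDim (CoordRing K n ⧸ J) ≤ 0) :
    idealOfVars (Fin (n + 1)) K ≤ J.radical := by
  have h0 : Ring.KrullDimLE 0 (CoordRing K n ⧸ J) := by
    rw [Ring.krullDimLE_iff]
    exact_mod_cast hdim
  rw [Ideal.krullDimLE_zero_quotient_iff_forall_minimalPrimes_isMaximal] at h0
  refine idealOfVars_le_radical_of_minimalPrimes fun p hp => ?_
  exact ((h0 p hp).eq_of_le isPrime_idealOfVars.ne_top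
    (hJ.le_idealOfVars_of_mem_minimalPrimes hp)).ge

/-- A linear form not contained in a minimal prime of `J` other than the irrelevant ideal cuts the
dimension down by one. -/
lemma ringKrullDim_quotient_sup_span_le {J : Ideal (CoordRing K n)} (hJ : IsHomogIdeal J)
    {d : ℕ} (hdim : ringKrullDim (CoordRing K n ⧸ J) ≤ (d + 1 : ℕ)) {l : CoordRing K n}
    (hl : ∀ p ∈ J.minimalPrimes, ¬ idealOfVars (Fin (n + 1)) K ≤ p → l ∉ p) :
    ringKrullDim (CoordRing K n ⧸ (J ⊔ Ideal.span {l})) ≤ d := by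
  by_cases hm : ∃ p ∈ J.minimalPrimes, idealOfVars (Fin (n + 1)) K ≤ p
  · obtain ⟨p, hp, hmp⟩ := hm
    obtain rfl : p = idealOfVars (Fin (n + 1)) K :=
      le_antisymm (hJ.le_idealOfVars_of_mem_minimalPrimes hp) hmp
    have h0 : Ring.KrullDimLE 0 (CoordRing K n ⧸ J) := by
      rw [Ideal.krullDimLE_zero_quotient_iff_forall_minimalPrimes_isMaximal]
      intro q hq
      have hle := hJ.le_idealOfVars_of_mem_minimalPrimes hq
      rw [le_antisymm hle (hp.2 hq.1 hle)]
      exact isMaximal_idealOfVars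
    rw [Ring.krullDimLE_iff] at h0
    refine (ringKrullDim_le_of_surjective (Ideal.Quotient.factor le_sup_left)
      (Ideal.Quotient.factor_surjective _)).trans (h0.trans ?_)
    exact_mod_cast Nat.zero_le d
  · push Not at hm
    have := (ringKrullDim_quotient_sup_span_add_one_le fun p hp => hl p hp (hm p hp)).trans hdim
    rw [Nat.cast_add, Nat.cast_one] at this
    exact (WithBot.add_le_add_iff_right' (α := ℕ) WithBot.one_ne_bot
      (fun h => ENat.one_ne_top (WithBot.coe_injective h))).mp this

/-- If `(J, g)` is primary to the irrelevant ideal for some `g`, then so is `(J, l)` for some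
linear form `l`. -/
lemma exists_linearForm_idealOfVars_le_radical [Infinite K] {J : Ideal (CoordRing K n)}
    (hJ : IsHomogIdeal J) {g : CoordRing K n}
    (hg : g ∈ idealOfVars (Fin (n + 1)) K)
    (hrad : idealOfVars (Fin (n + 1)) K ≤ (J ⊔ Ideal.span {g}).radical) :
    ∃ a : Fin (n + 1) → K,
      idealOfVars (Fin (n + 1)) K ≤ (J ⊔ Ideal.span {linearForm a}).radical := by
  obtain ⟨a, ha⟩ := exists_linearForm_forall_notMem
    (S := {p ∈ J.minimalPrimes | ¬ idealOfVars (Fin (n + 1)) K ≤ p})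
    ((J.finite_minimalPrimes_of_isNoetherianRing _).subset (Set.sep_subset _ _)) fun p hp => hp.2
  refine ⟨a, idealOfVars_le_radical_of_minimalPrimes fun q hq => ?_⟩
  have hJl : IsHomogIdeal (J ⊔ Ideal.span {linearForm a}) :=
    hJ.sup (isHomogIdeal_span (by rintro g rfl; exact ⟨1, isHomogeneous_linearForm a⟩))
  have hqm := hJl.le_idealOfVars_of_mem_minimalPrimes hq
  have hqprime := hq.1.1
  obtain ⟨p, hp, hpq⟩ := Ideal.exists_minimalPrimes_le (le_sup_left.trans hq.1.2)
  have hpprime := hp.1.1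
  by_cases hmp : idealOfVars (Fin (n + 1)) K ≤ p
  · exact hmp.trans hpq
  have hap : linearForm a ∉ p := ha p ⟨hp, hmp⟩
  by_contra hne
  have hmin : idealOfVars (Fin (n + 1)) K ∈ (p ⊔ Ideal.span {g}).minimalPrimes := by
    refine ⟨⟨isPrime_idealOfVars, sup_le (hpq.trans hqm) ?_⟩, ?_⟩
    · rwa [Ideal.span_singleton_le_iff_mem]
    · rintro r ⟨hr, hpr⟩ -
      exact hrad.trans ((Ideal.radical_mono (sup_le_sup_right hp.1.2 _)).trans
        ((Ideal.IsPrime.radical_le_iff hr).mpr hpr))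
  have hheight := Ideal.map_height_le_one_of_mem_minimalPrimes hmin
  have hmap : ∀ r : Ideal (CoordRing K n), r.IsPrime → p ≤ r →
      (r.map (Ideal.Quotient.mk p)).IsPrime := fun r hr hpr =>
    Ideal.map_isPrime_of_surjective Ideal.Quotient.mk_surjective (by rwa [Ideal.mk_ker])
  have hlt : ∀ r s : Ideal (CoordRing K n), p ≤ r → r ≤ s → ¬ s ≤ r →
      r.map (Ideal.Quotient.mk p) < s.map (Ideal.Quotient.mk p) := by
    intro r s hpr hrs hsr
    refine lt_of_le_not_ge (Ideal.map_mono hrs) fun h => hsr ?_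
    have := Ideal.comap_mono (f := Ideal.Quotient.mk p) h
    rwa [Ideal.comap_map_mk (hpr.trans hrs), Ideal.comap_map_mk hpr] at this
  have i1 := hmap p hpprime le_rfl
  have i2 := hmap q hqprime hpq
  have i3 := hmap _ isPrime_idealOfVars (hpq.trans hqm)
  have h1 := Ideal.height_add_one_le_of_lt_of_isPrime (hlt p q le_rfl hpq fun h => hap
    (h (hq.1.2 (Ideal.mem_sup_right (Ideal.mem_span_singleton_self _)))))
  have h2 := Ideal.height_add_one_le_of_lt_of_isPrime (hlt q _ hpq hqm hne)
  have h3 : (1 : ℕ∞) + 1 ≤ 1 :=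
    (add_le_add_left (le_add_self.trans h1) 1).trans (h2.trans hheight)
  exact absurd h3 (by decide)

end Dimension

section MacaulayBound

variable {K : Type*} [Field K] {n : ℕ}

lemma isRegularMod_span_X_image {σ : Type*} {s : Set σ} {i : σ} (hi : i ∉ s) :
    IsRegularMod (Ideal.span (X '' s : Set (MvPolynomial σ K))) (X i) := by
  intro z hz
  rw [mem_ideal_span_X_image] at hz ⊢
  intro m hm
  obtain ⟨j, hj, hmj⟩ := hz (m + Finsupp.single i 1) (by
    rw [mem_support_iff, mul_comm, coeff_mul_X]
    exact mem_support_iff.mp hm)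
  refine ⟨j, hj, ?_⟩
  have hij : i ≠ j := fun h => hi (h ▸ hj)
  simpa [Finsupp.single_apply, hij] using hmj

lemma isRegularSeqMod_map_X {σ : Type*} {s : Set σ} {l : List σ} (hl : l.Nodup)
    (hs : ∀ i ∈ l, i ∉ s) :
    IsRegularSeqMod (Ideal.span (X '' s : Set (MvPolynomial σ K))) (l.map X) := by
  induction l generalizing s with
  | nil => trivial
  | cons i l ih =>
    rw [List.nodup_cons] at hl
    refine ⟨isRegularMod_span_X_image (hs i (by simp)), ?_⟩
    have := ih (s := insert i s) hl.2 fun j hj hjs => by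
      rcases Set.mem_insert_iff.mp hjs with rfl | h
      · exact hl.1 hj
      · exact hs j (by simp [hj]) h
    rwa [Set.image_insert_eq, Ideal.span_insert, sup_comm] at this

lemma aeval_linearForm (V : Matrix (Fin (n + 1)) (Fin (n + 1)) K) (c : Fin (n + 1) → K) :
    aeval (fun i => linearForm (V i)) (linearForm c) = linearForm (Matrix.vecMul c V) := by
  simp only [linearForm, map_sum, map_mul, aeval_X, Matrix.vecMul, dotProduct, aeval_C,
    algebraMap_eq, Finset.mul_sum, Finset.sum_mul, ← mul_assoc]
  exact Finset.sum_comm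

/-- The linear change of coordinates given by an invertible matrix. -/
noncomputable def linearCoordChange {V W : Matrix (Fin (n + 1)) (Fin (n + 1)) K}
    (hVW : V * W = 1) : CoordRing K n ≃ₐ[K] CoordRing K n :=
  AlgEquiv.ofAlgHom (aeval fun i => linearForm (V i)) (aeval fun i => linearForm (W i))
    (by
      ext1 i
      have h : Matrix.vecMul (W i) V = Pi.single i 1 := by
        rw [← Matrix.mul_apply_eq_vecMul, mul_eq_one_comm.mp hVW]
        ext j
        simp [Matrix.one_apply, Pi.single_apply, eq_comm]
      rw [AlgHom.comp_apply, aeval_X, aeval_linearForm, h, linearForm_single, AlgHom.id_apply])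
    (by
      ext1 i
      have h : Matrix.vecMul (V i) W = Pi.single i 1 := by
        rw [← Matrix.mul_apply_eq_vecMul, hVW]
        ext j
        simp [Matrix.one_apply, Pi.single_apply, eq_comm]
      rw [AlgHom.comp_apply, aeval_X, aeval_linearForm, h, linearForm_single, AlgHom.id_apply])

lemma linearCoordChange_X {V W : Matrix (Fin (n + 1)) (Fin (n + 1)) K} (hVW : V * W = 1)
    (i : Fin (n + 1)) : linearCoordChange hVW (X i) = linearForm (V i) := by
  simp [linearCoordChange]

/-- As many linear forms as variables without a common zero form a regular sequence and generate
the irrelevant ideal. -/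
lemma isRegularSeqMod_linearForms (V : Matrix (Fin (n + 1)) (Fin (n + 1)) K)
    (hrad : idealOfVars (Fin (n + 1)) K ≤
      (Ideal.ofList (List.ofFn fun i => linearForm (V i))).radical) :
    IsRegularSeqMod ⊥ (List.ofFn fun i => linearForm (V i)) ∧
      idealOfVars (Fin (n + 1)) K ≤ Ideal.ofList (List.ofFn fun i => linearForm (V i)) := by
  have hdet : V.det ≠ 0 := by
    intro h0
    obtain ⟨x, hx0, hx⟩ := Matrix.exists_mulVec_eq_zero_iff.mpr h0
    refine hx0 (funext fun j => ?_)
    obtain ⟨N, hN⟩ := hrad (Ideal.subset_span ⟨j, rfl⟩ : X j ∈ idealOfVars (Fin (n + 1)) K)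
    have hker : Ideal.ofList (List.ofFn fun i => linearForm (V i)) ≤
        RingHom.ker (eval x : CoordRing K n →+* K) := by
      refine Ideal.span_le.mpr ?_
      intro g hg
      obtain ⟨i, rfl⟩ := (List.mem_ofFn' _ _).mp hg
      rw [SetLike.mem_coe, RingHom.mem_ker, eval_linearForm]
      exact congrFun hx i
    have := hker hN
    rw [RingHom.mem_ker, map_pow, eval_X] at this
    exact eq_zero_of_pow_eq_zero this
  have hVW : V * V⁻¹ = 1 := Matrix.mul_nonsing_inv V (isUnit_iff_ne_zero.mpr hdet)
  let e := linearCoordChange hVW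
  have hlist : List.ofFn (fun i => linearForm (V i)) =
      ((List.finRange (n + 1)).map X).map e := by
    rw [List.map_map, List.ofFn_eq_map]
    exact List.map_congr_left fun i _ => (linearCoordChange_X hVW i).symm
  constructor
  · have h := isRegularSeqMod_map_X (K := K) (s := ∅) (List.nodup_finRange (n + 1)) (by simp)
    rw [Set.image_empty, Ideal.span_empty] at h
    have h' := h.map e.toRingEquiv
    rw [Ideal.map_bot] at h'
    rw [hlist]
    exact h'
  · refine Ideal.span_le.mpr ?_
    rintro _ ⟨i, rfl⟩
    have h1 : (X i : CoordRing K n) = linearForm (Matrix.vecMul (V⁻¹ i) V) := by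
      rw [← Matrix.mul_apply_eq_vecMul, mul_eq_one_comm.mp hVW, ← linearForm_single]
      congr 1
      ext j
      simp [Matrix.one_apply, Pi.single_apply, eq_comm]
    rw [h1, ← aeval_linearForm, linearForm, map_sum]
    refine Ideal.sum_mem _ fun j _ => ?_
    rw [map_mul, aeval_X]
    exact Ideal.mul_mem_left _ _ (Ideal.subset_span ((List.mem_ofFn' _ _).mpr ⟨j, rfl⟩))

lemma isHomogIdeal_ofList {l : List (CoordRing K n)}
    (hl : ∀ g ∈ l, ∃ e, g.IsHomogeneous e) : IsHomogIdeal (Ideal.ofList l) :=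
  isHomogIdeal_span hl

lemma isHomogIdeal_bot : IsHomogIdeal (⊥ : Ideal (CoordRing K n)) := by
  rw [← Ideal.ofList_nil]
  exact isHomogIdeal_ofList (by simp)

/-- As many forms `g` of degrees `e > 0` as variables, with only the trivial common zero, form a
regular sequence, and every form of degree greater than `∑ (e - 1)` lies in the ideal they generate.
Here the linear forms among them are listed separately. -/
theorem macaulay_bound [Infinite K] (V : List (Fin (n + 1) → K)) (G : List (CoordRing K n × ℕ))
    (hG : ∀ p ∈ G, 0 < p.2 ∧ p.1.IsHomogeneous p.2) (hlen : V.length + G.length = n + 1)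
    (hrad : idealOfVars (Fin (n + 1)) K ≤
      (Ideal.ofList (V.map linearForm ++ G.map Prod.fst)).radical) :
    IsRegularSeqMod ⊥ (V.map linearForm ++ G.map Prod.fst) ∧
      ∀ d, (G.map fun p => p.2 - 1).sum < d → ∀ F : CoordRing K n, F.IsHomogeneous d →
        F ∈ Ideal.ofList (V.map linearForm ++ G.map Prod.fst) := by
  induction G using List.reverseRecOn generalizing V with
  | nil =>
    obtain ⟨M, rfl⟩ : ∃ M : Fin (n + 1) → Fin (n + 1) → K, V = List.ofFn M := by
      rw [List.length_nil, add_zero] at hlen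
      refine ⟨fun i => V.get (i.cast hlen.symm), ?_⟩
      refine List.ext_get (by simp [hlen]) fun i h1 h2 => by
        rw [List.get_ofFn]
        rfl
    simp only [List.map_nil, List.append_nil, List.map_ofFn, Function.comp_def] at hrad ⊢
    obtain ⟨h1, h2⟩ := isRegularSeqMod_linearForms M hrad
    exact ⟨h1, fun d hd F hF => h2 (mem_idealOfVars_of_isHomogeneous (by simpa using hd) hF)⟩
  | append_singleton G p ih =>
    obtain ⟨g, e⟩ := p
    obtain ⟨he, hg⟩ := hG (g, e) (by simp)
    have hG' : ∀ p ∈ G, 0 < p.2 ∧ p.1.IsHomogeneous p.2 := fun p hp => hG p (by simp [hp])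
    set L := V.map linearForm ++ G.map Prod.fst with hL
    have hLhom : ∀ q ∈ L, ∃ e, q.IsHomogeneous e := by
      intro q hq
      rcases List.mem_append.mp hq with hq | hq
      · obtain ⟨a, -, rfl⟩ := List.mem_map.mp hq
        exact ⟨1, isHomogeneous_linearForm a⟩
      · obtain ⟨p, hp, rfl⟩ := List.mem_map.mp hq
        exact ⟨p.2, (hG' p hp).2⟩
    have hJ := isHomogIdeal_ofList hLhom
    have hlist : V.map linearForm ++ (G ++ [(g, e)]).map Prod.fst = L ++ [g] := by
      simp [hL]
    rw [hlist] at hrad ⊢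
    rw [Ideal.ofList_append, Ideal.ofList_singleton] at hrad ⊢
    obtain ⟨a, ha⟩ := exists_linearForm_idealOfVars_le_radical hJ
      (mem_idealOfVars_of_isHomogeneous he hg) hrad
    have hcons : (a :: V).map linearForm ++ G.map Prod.fst = linearForm a :: L := by simp [hL]
    have ih' := ih (a :: V) hG' (by simp at hlen ⊢; omega)
    rw [hcons, Ideal.ofList_cons, sup_comm] at ih'
    obtain ⟨hreg, hbound⟩ := ih' ha
    have hrot := hreg.rotate isHomogIdeal_bot one_pos (isHomogeneous_linearForm a) hLhom
    rw [isRegularSeqMod_append, bot_sup_eq] at hrot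
    refine ⟨?_, ?_⟩
    · rw [isRegularSeqMod_append, bot_sup_eq]
      exact ⟨hrot.1, hrot.2.1.of_mem_radical (hrad (mem_idealOfVars_of_isHomogeneous one_pos
        (isHomogeneous_linearForm a))), trivial⟩
    · simp only [List.map_append, List.map_cons, List.map_nil, List.sum_append, List.sum_singleton]
      exact mem_sup_span_of_exchange hJ he (isHomogeneous_linearForm a) hg hrot.2.1 hrad hbound

end MacaulayBound

section Saturation

variable {K : Type*} [Field K] {n : ℕ}

/-- The saturation of `J` with respect to the irrelevant ideal. -/
def saturation (J : Ideal (CoordRing K n)) : Ideal (CoordRing K n) where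
  carrier := {F | ∀ j : Fin (n + 1), ∃ N : ℕ, X j ^ N * F ∈ J}
  zero_mem' := fun j => ⟨0, by simp⟩
  add_mem' := by
    intro F G hF hG j
    obtain ⟨N, hN⟩ := hF j
    obtain ⟨M, hM⟩ := hG j
    refine ⟨N + M, ?_⟩
    have h : (X j ^ (N + M) * (F + G) : CoordRing K n)
        = X j ^ M * (X j ^ N * F) + X j ^ N * (X j ^ M * G) := by ring
    rw [h]
    exact J.add_mem (J.mul_mem_left _ hN) (J.mul_mem_left _ hM)
  smul_mem' := by
    intro c F hF j
    obtain ⟨N, hN⟩ := hF j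
    refine ⟨N, ?_⟩
    rw [smul_eq_mul, mul_left_comm]
    exact J.mul_mem_left _ hN

lemma le_saturation (J : Ideal (CoordRing K n)) : J ≤ saturation J :=
  fun _ hF _ => ⟨0, by simpa using hF⟩

lemma IsHomogIdeal.saturation {J : Ideal (CoordRing K n)} (hJ : IsHomogIdeal J) :
    IsHomogIdeal (saturation J) := by
  intro F hF e j
  obtain ⟨N, hN⟩ := hF j
  refine ⟨N, ?_⟩
  have hX : (X j ^ N : CoordRing K n).IsHomogeneous N := isHomogeneous_X_pow j N
  rw [← homogeneousComponent_add_mul hX]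
  exact hJ _ hN _

lemma mem_saturation_of_X_mul_mem {J : Ideal (CoordRing K n)} {F : CoordRing K n}
    (h : ∀ j, X j * F ∈ saturation J) : F ∈ saturation J := by
  intro j
  obtain ⟨N, hN⟩ := h j j
  exact ⟨N + 1, by rwa [pow_succ, mul_assoc]⟩

lemma not_idealOfVars_le_of_mem_associatedPrimes {J p : Ideal (CoordRing K n)}
    (hp : p ∈ associatedPrimes (CoordRing K n) (CoordRing K n ⧸ saturation J)) :
    ¬ idealOfVars (Fin (n + 1)) K ≤ p := by
  rw [AssociatedPrimes.mem_iff, isAssociatedPrime_iff] at hp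
  obtain ⟨hprime, x, rfl⟩ := hp
  obtain ⟨z, rfl⟩ := Ideal.Quotient.mk_surjective x
  intro hle
  have hz : z ∈ saturation J := by
    refine mem_saturation_of_X_mul_mem fun j => ?_
    have hj := hle (Ideal.subset_span ⟨j, rfl⟩ : X j ∈ idealOfVars (Fin (n + 1)) K)
    rw [Submodule.mem_colon_singleton, Submodule.mem_bot] at hj
    rw [← Ideal.Quotient.eq_zero_iff_mem]
    exact hj
  rw [Ideal.Quotient.eq_zero_iff_mem.mpr hz] at hprime
  exact hprime.ne_top (by simp)

lemma isRegularMod_of_forall_associatedPrimes {R : Type*} [CommRing R] [IsNoetherianRing R]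
    {A : Ideal R} {l : R} (hl : ∀ p ∈ associatedPrimes R (R ⧸ A), l ∉ p) :
    IsRegularMod A l := by
  intro z hz
  by_contra hzA
  have hmem : l ∈ {r : R | ∃ x : R ⧸ A, x ≠ 0 ∧ r • x = 0} :=
    ⟨Ideal.Quotient.mk A z, fun h => hzA (Ideal.Quotient.eq_zero_iff_mem.mp h),
      Ideal.Quotient.eq_zero_iff_mem.mpr hz⟩
  rw [← biUnion_associatedPrimes_eq_zero_divisors] at hmem
  obtain ⟨p, hp, hlp⟩ := Set.mem_iUnion₂.mp hmem
  exact hl p hp hlp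

end Saturation

section HilbertFunction

variable {K : Type*} [Field K] {n : ℕ}

/-- The forms of degree `l` in the ideal `A`. -/
noncomputable def degreePart (A : Ideal (CoordRing K n)) (l : ℕ) : Submodule K (CoordRing K n) :=
  homogeneousSubmodule (Fin (n + 1)) K l ⊓ A.restrictScalars K

instance (l : ℕ) : Module.Finite K (homogeneousSubmodule (Fin (n + 1)) K l) :=
  Module.Finite.iff_fg.mpr (homogeneousSubmodule_fg _ _ l)

instance (A : Ideal (CoordRing K n)) (l : ℕ) : Module.Finite K (degreePart A l) :=
  Submodule.finiteDimensional_of_le inf_le_left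

lemma hilbertBeta_eq (J : Ideal (CoordRing K n)) (l : ℕ) :
    hilbertBeta J l = (Module.finrank K (homogeneousSubmodule (Fin (n + 1)) K l) : ℤ) -
      Module.finrank K (degreePart (saturation J) l) :=
  rfl

lemma degreePart_sup_span {A : Ideal (CoordRing K n)} (hA : IsHomogIdeal A)
    {l : CoordRing K n} (hl : l.IsHomogeneous 1) (d : ℕ) :
    degreePart (A ⊔ Ideal.span {l}) (d + 1) =
      degreePart A (d + 1) ⊔
        (homogeneousSubmodule (Fin (n + 1)) K d).map (LinearMap.mulLeft K l) := by
  apply le_antisymm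
  · rintro F ⟨hF, hFA⟩
    obtain ⟨j, hj, u, hu, hju⟩ := Submodule.mem_sup.mp hFA
    obtain ⟨w, rfl⟩ := Ideal.mem_span_singleton'.mp hu
    rw [← homogeneousComponent_eq_self hF, ← hju, map_add, mul_comm w,
      homogeneousComponent_add_mul hl]
    exact Submodule.add_mem_sup ⟨homogeneousComponent_isHomogeneous _ _, hA _ hj _⟩
      ⟨_, homogeneousComponent_isHomogeneous _ _, rfl⟩
  · refine sup_le (fun F hF => ⟨hF.1, Ideal.mem_sup_left hF.2⟩) ?_
    rintro _ ⟨G, hG, rfl⟩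
    refine ⟨?_, Ideal.mem_sup_right ?_⟩
    · have h := hl.mul hG
      rw [add_comm 1 d] at h
      exact h
    · exact Ideal.mul_mem_right _ _ (Ideal.mem_span_singleton_self l)

lemma degreePart_sup_span_zero {A : Ideal (CoordRing K n)} (hA : IsHomogIdeal A)
    {l : CoordRing K n} (hl : l.IsHomogeneous 1) :
    degreePart (A ⊔ Ideal.span {l}) 0 = degreePart A 0 := by
  apply le_antisymm
  · rintro F ⟨hF, hFA⟩
    obtain ⟨j, hj, u, hu, hju⟩ := Submodule.mem_sup.mp hFA
    obtain ⟨w, rfl⟩ := Ideal.mem_span_singleton'.mp hu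
    refine ⟨hF, ?_⟩
    rw [← homogeneousComponent_eq_self hF, ← hju, map_add, mul_comm w,
      homogeneousComponent_mul_of_lt hl one_pos, add_zero]
    exact hA _ hj _
  · exact fun F hF => ⟨hF.1, Ideal.mem_sup_left hF.2⟩

lemma map_mulLeft_degreePart_le {A : Ideal (CoordRing K n)}
    {l : CoordRing K n} (hl : l.IsHomogeneous 1) (d : ℕ) :
    (degreePart A d).map (LinearMap.mulLeft K l) ≤ degreePart A (d + 1) ⊓
      (homogeneousSubmodule (Fin (n + 1)) K d).map (LinearMap.mulLeft K l) := by
  rintro _ ⟨G, hG, rfl⟩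
  refine ⟨⟨?_, A.mul_mem_left _ hG.2⟩, G, hG.1, rfl⟩
  have h := hl.mul hG.1
  rw [add_comm 1 d] at h
  exact h

lemma finrank_map_mulLeft {l : CoordRing K n} (hl : l ≠ 0) (W : Submodule K (CoordRing K n)) :
    Module.finrank K (W.map (LinearMap.mulLeft K l)) = Module.finrank K W :=
  (Submodule.equivMapOfInjective _ (mul_right_injective₀ hl) W).finrank_eq.symm

lemma finrank_degreePart_sup_span {A : Ideal (CoordRing K n)} (hA : IsHomogIdeal A)
    {l : CoordRing K n} (hl : l.IsHomogeneous 1) (hl0 : l ≠ 0) (hreg : IsRegularMod A l) (d : ℕ) :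
    Module.finrank K (degreePart (A ⊔ Ideal.span {l}) (d + 1)) +
        Module.finrank K (degreePart A d) =
      Module.finrank K (degreePart A (d + 1)) +
        Module.finrank K (homogeneousSubmodule (Fin (n + 1)) K d) := by
  have hinf : degreePart A (d + 1) ⊓
      (homogeneousSubmodule (Fin (n + 1)) K d).map (LinearMap.mulLeft K l) =
      (degreePart A d).map (LinearMap.mulLeft K l) := by
    refine le_antisymm ?_ (map_mulLeft_degreePart_le hl d)
    rintro _ ⟨⟨_, hA'⟩, G, hG, rfl⟩
    exact ⟨G, ⟨hG, hreg _ hA'⟩, rfl⟩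
  have h := Submodule.finrank_sup_add_finrank_inf_eq (degreePart A (d + 1))
    ((homogeneousSubmodule (Fin (n + 1)) K d).map (LinearMap.mulLeft K l))
  rwa [hinf, ← degreePart_sup_span hA hl, finrank_map_mulLeft hl0, finrank_map_mulLeft hl0] at h

lemma finrank_add_finrank_degreePart_le {A : Ideal (CoordRing K n)} (hA : IsHomogIdeal A)
    {l : CoordRing K n} (hl : l.IsHomogeneous 1) (hl0 : l ≠ 0) {d : ℕ}
    (htop : ∀ F : CoordRing K n, F.IsHomogeneous (d + 1) → F ∈ A ⊔ Ideal.span {l}) :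
    Module.finrank K (homogeneousSubmodule (Fin (n + 1)) K (d + 1)) +
        Module.finrank K (degreePart A d) ≤
      Module.finrank K (degreePart A (d + 1)) +
        Module.finrank K (homogeneousSubmodule (Fin (n + 1)) K d) := by
  have h := Submodule.finrank_sup_add_finrank_inf_eq (degreePart A (d + 1))
    ((homogeneousSubmodule (Fin (n + 1)) K d).map (LinearMap.mulLeft K l))
  have heq : degreePart (A ⊔ Ideal.span {l}) (d + 1) =
      homogeneousSubmodule (Fin (n + 1)) K (d + 1) :=
    le_antisymm inf_le_left fun F hF => ⟨hF, htop F hF⟩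
  have hinf : Module.finrank K ((degreePart A d).map (LinearMap.mulLeft K l)) ≤ _ :=
    Submodule.finrank_mono (map_mulLeft_degreePart_le hl d)
  rw [← degreePart_sup_span hA hl, heq, finrank_map_mulLeft hl0] at h
  rw [finrank_map_mulLeft hl0] at hinf
  linarith

/-- The difference function of the Hilbert function is the Hilbert function of the quotient by a
linear form which is regular modulo the saturation. -/
lemma hilbertGamma_eq {J : Ideal (CoordRing K n)} (hJ : IsHomogIdeal J) {l : CoordRing K n}
    (hl : l.IsHomogeneous 1) (hl0 : l ≠ 0) (hreg : IsRegularMod (saturation J) l) (d : ℕ) :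
    hilbertGamma J d = (Module.finrank K (homogeneousSubmodule (Fin (n + 1)) K d) : ℤ) -
      Module.finrank K (degreePart (saturation J ⊔ Ideal.span {l}) d) := by
  cases d with
  | zero =>
    rw [degreePart_sup_span_zero hJ.saturation hl]
    rfl
  | succ d =>
    have h := finrank_degreePart_sup_span hJ.saturation hl hl0 hreg d
    simp only [hilbertGamma, hilbertBeta_eq]
    zify at h
    linarith

lemma not_idealOfVars_le_bot : ¬ idealOfVars (Fin (n + 1)) K ≤ ⊥ := fun h =>
  X_ne_zero (R := K) (0 : Fin (n + 1)) (h (Ideal.subset_span ⟨0, rfl⟩))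

end HilbertFunction

theorem proposition2p6 {K : Type*} [Field K] [IsAlgClosed K] {n : ℕ} (hn : 2 ≤ n)
    (f : Fin (n - 2) → CoordRing K n) (k : Fin (n - 2) → ℕ)
    (hS : IsCompleteIntersectionSurface f k)
    (I : Ideal (CoordRing K n)) (hC : IsCurve I)
    (hCS : ∀ j, f j ∈ idealSheafSections I (k j)) :
    ForGeneralHyperplane fun a : Fin (n + 1) → K =>
      ∀ i : ℕ, ∑ j, k j ≤ i →
        hilbertGamma (hyperplaneSection I a) (i + 1) ≤ hilbertGamma (hyperplaneSection I a) i := by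
  have hfin : ∀ J : Ideal (CoordRing K n),
      {p ∈ J.minimalPrimes | ¬ idealOfVars (Fin (n + 1)) K ≤ p}.Finite := fun J =>
    (J.finite_minimalPrimes_of_isNoetherianRing _).subset (Set.sep_subset _ _)
  have hlin : ∀ a : Fin (n + 1) → K, IsHomogIdeal (Ideal.span {linearForm a}) := fun a =>
    isHomogIdeal_span (by rintro g rfl; exact ⟨1, isHomogeneous_linearForm a⟩)
  set J₁ := Ideal.span (Set.range f) with hJ₁def
  have hJ₁ : IsHomogIdeal J₁ :=
    isHomogIdeal_span (by rintro _ ⟨j, rfl⟩; exact ⟨k j, hS.isHomogeneous j⟩)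
  obtain ⟨e, F, hF, hF0, hFa⟩ :=
    exists_isHomogeneous_forall_linearForm_notMem (hfin J₁) fun p hp => hp.2
  refine ⟨e, F, hF, hF0, fun a _ ha i hi => ?_⟩
  have hJ₂ : IsHomogIdeal (J₁ ⊔ Ideal.span {linearForm a}) := hJ₁.sup (hlin a)
  have hdim₂ := ringKrullDim_quotient_sup_span_le hJ₁ (d := 2) hS.dim_eq_two.le
    fun p hp hmp => hFa a ha p ⟨hp, hmp⟩
  set J₂ := J₁ ⊔ Ideal.span {linearForm a} with hJ₂def
  set J := hyperplaneSection I a with hJdef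
  have hJ : IsHomogIdeal J := hC.isHomogeneous.sup (hlin a)
  have hJ₂J : J₂ ≤ saturation J := by
    refine sup_le (Ideal.span_le.mpr ?_) (le_sup_right.trans (le_saturation J))
    rintro _ ⟨j, rfl⟩
    intro i
    obtain ⟨N, hN⟩ := (hCS j).2 i
    exact ⟨N, Ideal.mem_sup_left hN⟩
  obtain ⟨b, hb⟩ := exists_linearForm_forall_notMem
    (S := insert ⊥ ({p ∈ J₂.minimalPrimes | ¬ idealOfVars (Fin (n + 1)) K ≤ p} ∪
      associatedPrimes (CoordRing K n) (CoordRing K n ⧸ saturation J)))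
    (((hfin J₂).union (associatedPrimes.finite _ _)).insert _) (by
      rintro p (rfl | hp | hp)
      · exact not_idealOfVars_le_bot
      · exact hp.2
      · exact not_idealOfVars_le_of_mem_associatedPrimes hp)
  have hb0 : linearForm b ≠ 0 := fun h => hb ⊥ (Or.inl rfl) h
  have hbreg : IsRegularMod (saturation J) (linearForm b) :=
    isRegularMod_of_forall_associatedPrimes fun p hp => hb p (Or.inr (Or.inr hp))
  have hJ₃ : IsHomogIdeal (J₂ ⊔ Ideal.span {linearForm b}) := hJ₂.sup (hlin b)
  have hdim₃ := ringKrullDim_quotient_sup_span_le hJ₂ (d := 1) hdim₂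
    fun p hp hmp => hb p (Or.inr (Or.inl ⟨hp, hmp⟩))
  set J₃ := J₂ ⊔ Ideal.span {linearForm b} with hJ₃def
  obtain ⟨c, hc⟩ := exists_linearForm_forall_notMem
    (S := insert ⊥ {p ∈ J₃.minimalPrimes | ¬ idealOfVars (Fin (n + 1)) K ≤ p})
    ((hfin J₃).insert _) (by
      rintro p (rfl | hp)
      · exact not_idealOfVars_le_bot
      · exact hp.2)
  have hc0 : linearForm c ≠ 0 := fun h => hc ⊥ (Or.inl rfl) h
  have hdim₄ := ringKrullDim_quotient_sup_span_le hJ₃ (d := 0) hdim₃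
    fun p hp hmp => hc p (Or.inr ⟨hp, hmp⟩)
  have hrad := idealOfVars_le_radical_of_ringKrullDim_le_zero (hJ₃.sup (hlin c)) hdim₄
  let G : List (CoordRing K n × ℕ) := List.ofFn fun j => (f j, k j)
  have hlist : Ideal.ofList ([a, b, c].map linearForm ++ G.map Prod.fst) =
      J₃ ⊔ Ideal.span {linearForm c} := by
    have hG : Ideal.ofList (G.map Prod.fst) = J₁ := by
      simp [G, Ideal.ofList, List.map_ofFn, Function.comp_def, List.mem_ofFn', Set.range, hJ₁def]
    rw [Ideal.ofList_append, hG]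
    simp only [List.map_cons, List.map_nil, Ideal.ofList_cons, Ideal.ofList_nil, sup_bot_eq,
      hJ₃def, hJ₂def]
    ac_rfl
  have hbound := (macaulay_bound [a, b, c] G
    (by
      intro p hp
      obtain ⟨j, rfl⟩ := (List.mem_ofFn' _ _).mp hp
      exact ⟨hS.degree_pos j, hS.isHomogeneous j⟩)
    (by simp [G]; omega) (hlist ▸ hrad)).2
  have hsum : (G.map fun p => p.2 - 1).sum ≤ ∑ j, k j := by
    simp only [G, List.map_ofFn, Function.comp_def, List.sum_ofFn]
    exact Finset.sum_le_sum fun j _ => Nat.sub_le _ _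
  have h := finrank_add_finrank_degreePart_le (hJ.saturation.sup (hlin b))
    (isHomogeneous_linearForm c) hc0 (d := i) fun F hF =>
      (sup_le_sup_right (sup_le_sup_right hJ₂J _) _)
        (hlist ▸ hbound (i + 1) (by omega) F hF)
  have h1 := hilbertGamma_eq hJ (isHomogeneous_linearForm b) hb0 hbreg (i + 1)
  have h2 := hilbertGamma_eq hJ (isHomogeneous_linearForm b) hb0 hbreg i
  omega
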